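/- Let $X$ be a random variable taking values in a measurable space $\mathcal X$, let $\mathcal T\subseteq\mathbb R^k$ be compact, and let $\hat\theta\colon\mathcal X\times\mathcal T\to\mathbb R$ be such that $\hat\theta(\cdot,t)$ is measurable for every $t\in\mathcal T$, $\hat\theta(x,\cdot)$ is continuous for every $x\in\mathcal X$, and $\sup_{x,t}|\hat\theta(x,t)|<\infty$. Let $\tau\colon\mathcal X\to\mathcal T$ be measurable with $\tau(x)\in\arg\min_{t\in\mathcal T}\hat\theta(x,t)$ for all $x$, and put $$\hat\theta_*(x)=\min_{t\in\mathcal T}\hat\theta(x,t),\qquad \hat\theta^*(x,x')=\hat\theta(x,\tau(x')).$$ Let $\theta\colon\mathcal T\to\mathbb R$ be a function that attains a minimum $\theta_*=\min_{t\in\mathcal T}\theta(t)$, and let $\beta$ be a constant, not depending on $t$, with $|E(\hat\theta(X,t))-\theta(t)|\le\beta$ for all $t\in\mathcal T$. Let $0<\alpha<1$. For $N\ge 2$ let $\chi_1,\dots,\chi_N,\chi_1',\dots,\chi_N'$ be i.i.d. realisations of $X$. Let $\bar Y_*$ and $S_*$ be the sample mean and the sample standard deviation (with factor $1/(N-1)$)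 of $(\hat\theta_*(\chi_i))_{i=1}^N$, let $\bar Y^*$ and $S^*$ be those of $(\hat\theta^*(\chi_i,\chi_i'))_{i=1}^N$, and let $t_{N-1}$ be the two-sided critical value of Student's t-distribution with $N-1$ degrees of freedom at confidence level $1-\alpha$. Then $$\left[\bar Y_*-t_{N-1}\frac{S_*}{\sqrt N}-\beta,\ \ \bar Y^*+t_{N-1}\frac{S^*}{\sqrt N}+\beta\right]$$ is an approximate confidence interval for $\theta_*$ with asymptotic confidence level at least $1-\alpha$: for every $\varepsilon>0$ there is an $N_0$ such that for all $N\ge N_0$, and for all such realisations on any probability space, $$P\left(\bar Y_*-t_{N-1}\frac{S_*}{\sqrt N}-\beta\le\theta_*\le\bar Y^*+t_{N-1}\frac{S^*}{\sqrt N}+\beta\right)\ge 1-\alpha-\varepsilon .$$ -/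

import Mathlib

open MeasureTheory ProbabilityTheory

noncomputable section

namespace ImpreciseEstimation

/-- The lower estimator: the minimum of `θhat x t` over `t`
(attained when the parameter set is compact and non-empty and `θhat x` is continuous). -/
def lowerEst {𝒳 T : Type*} (θhat : 𝒳 → T → ℝ) (x : 𝒳) : ℝ :=
  ⨅ t, θhat x t

/-- The upper estimator: `θhat x` evaluated at the minimiser chosen for a second point `x'`. -/
def upperEst {𝒳 T : Type*} (θhat : 𝒳 → T → ℝ) (τ : 𝒳 → T) (x x' : 𝒳) : ℝ :=
  θhat x (τ x')

/-- Sample mean of `y₁, …, y_N`. -/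
def sampleMean {N : ℕ} (y : Fin N → ℝ) : ℝ :=
  (∑ i, y i) / (N : ℝ)

/-- Sample standard deviation of `y₁, …, y_N`, with the factor `1 / (N - 1)`. -/
def sampleSD {N : ℕ} (y : Fin N → ℝ) : ℝ :=
  √((∑ i, (y i - sampleMean y) ^ 2) / ((N : ℝ) - 1))

/-- Student's t-distribution with `ν ≥ 1` degrees of freedom: the law of
`Z₀ / √((Z₁² + ⋯ + Z_ν²) / ν)` for independent standard normal `Z₀, …, Z_ν`. -/
def studentT (ν : ℕ) : Measure ℝ :=
  (Measure.pi fun _ : Fin (ν + 1) => gaussianReal 0 1).map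
    fun z => z 0 / √((∑ i : Fin ν, z i.succ ^ 2) / (ν : ℝ))

/-- Two-sided critical value of the t-distribution with `ν` degrees of freedom at confidence
level `1 - α`: the least `c ≥ 0` with `P(-c ≤ T ≤ c) ≥ 1 - α` for `T` having that distribution
(equality holds there, as the distribution has no atoms). -/
def tCrit (ν : ℕ) (α : ℝ) : ℝ :=
  sInf {c : ℝ | 0 ≤ c ∧ 1 - α ≤ (studentT ν).real (Set.Icc (-c) c)}

/-- Lower end of the confidence interval without bias correction, `ȳ - t_{N-1} s / √N`. -/
def lowerBound {N : ℕ} (α : ℝ) (y : Fin N → ℝ) : ℝ :=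
  sampleMean y - tCrit (N - 1) α * (sampleSD y / √(N : ℝ))

/-- Upper end of the confidence interval without bias correction, `ȳ + t_{N-1} s / √N`. -/
def upperBound {N : ℕ} (α : ℝ) (y : Fin N → ℝ) : ℝ :=
  sampleMean y + tCrit (N - 1) α * (sampleSD y / √(N : ℝ))

end ImpreciseEstimation

end

namespace ImpreciseEstimation

open Filter Topology Set

/-! Let `m₁` and `m₂` be the expectations of the lower and upper estimators. Minimising inside the
expectation can only decrease it, so `m₁ ≤ θstar + β` (`integral_lowerEst_le`). Given the second
point `x'`, the minimiser `τ x'` is merely some parameter value, independent of the first point, so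
`m₂ ≥ θstar - β` (`le_integral_upperEst`). The interval therefore misses `θstar` only if the
uncorrected lower bound exceeds `m₁` or the uncorrected upper bound falls below `m₂`. Each failure
has asymptotic probability at most `α / 2`, and a union bound finishes without any independence
between the two.

The one-sided estimate `eventually_real_lt_lowerBound` combines the central limit theorem, Slutsky's
theorem for the sample standard deviation, and `eventually_le_tCrit`, an asymptotic lower bound on
the critical values. The failure events depend only on the law of the sample, so limits are taken on
one infinite product space, and `N₀` serves every probability space. -/

/-! ### Probability measures on the line -/

/-- Symmetric intervals eventually capture almost all of the mass of a probability measure. -/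
lemma exists_lt_real_Icc (μ : Measure ℝ) [IsProbabilityMeasure μ] {p : ℝ} (hp : p < 1) :
    ∃ c : ℝ, 0 ≤ c ∧ p < μ.real (Icc (-c) c) := by
  have hmono : Monotone fun n : ℕ => Icc (-(n : ℝ)) n := fun m n h => by
    have : (m : ℝ) ≤ n := by exact_mod_cast h
    exact Icc_subset_Icc (by linarith) this
  have hU : ⋃ n : ℕ, Icc (-(n : ℝ)) n = univ := by
    refine eq_univ_of_forall fun x => mem_iUnion.2 ?_
    obtain ⟨n, hn⟩ := exists_nat_ge |x|
    exact ⟨n, abs_le.1 hn⟩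
  have h := tendsto_measure_iUnion_atTop (μ := μ) hmono
  rw [hU, measure_univ] at h
  have h' : Tendsto (fun n : ℕ => μ.real (Icc (-(n : ℝ)) n)) atTop (𝓝 1) := by
    simpa [Measure.real] using! (ENNReal.tendsto_toReal ENNReal.one_ne_top).comp h
  obtain ⟨n, hn⟩ := (h'.eventually (lt_mem_nhds hp)).exists
  exact ⟨n, n.cast_nonneg, hn⟩

/-- The portmanteau bound for closed sets, for convergence in distribution. -/
lemma TendstoInDistribution.eventually_real_preimage_lt
    {Ω : ℕ → Type*} {Ω' : Type*} {mΩ : ∀ n, MeasurableSpace (Ω n)} {mΩ' : MeasurableSpace Ω'}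
    {μ : ∀ n, Measure (Ω n)} [∀ n, IsProbabilityMeasure (μ n)]
    {μ' : Measure Ω'} [IsProbabilityMeasure μ'] {X : ∀ n, Ω n → ℝ} {Z : Ω' → ℝ}
    (h : TendstoInDistribution X atTop Z μ μ') {F : Set ℝ} (hF : IsClosed F) {b : ℝ}
    (hb : μ'.real (Z ⁻¹' F) < b) : ∀ᶠ n in atTop, (μ n).real (X n ⁻¹' F) < b := by
  have key := ProbabilityMeasure.limsup_measure_closed_le_of_tendsto h.tendsto hF
  have hlt : (μ'.map Z) F < ENNReal.ofReal b := by
    rw [Measure.map_apply_of_aemeasurable h.aemeasurable_limit hF.measurableSet,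
      ← ofReal_measureReal]
    exact (ENNReal.ofReal_lt_ofReal_iff (measureReal_nonneg.trans_lt hb)).2 hb
  filter_upwards [eventually_lt_of_limsup_lt (key.trans_lt hlt)] with n hn
  rw [ProbabilityMeasure.coe_mk,
    Measure.map_apply_of_aemeasurable (h.forall_aemeasurable n) hF.measurableSet] at hn
  exact (ENNReal.lt_ofReal_iff_toReal_lt (measure_ne_top _ _)).1 hn

lemma real_Icc_gaussianReal {c : ℝ} (hc : 0 ≤ c) :
    (gaussianReal 0 1).real (Icc (-c) c) = ∫ x in -c..c, gaussianPDFReal 0 1 x := by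
  rw [Measure.real, gaussianReal_apply_eq_integral _ one_ne_zero, ENNReal.toReal_ofReal
    (integral_nonneg fun x => gaussianPDFReal_nonneg _ _ _), integral_Icc_eq_integral_Ioc,
    intervalIntegral.integral_of_le (by linarith)]

/-- By symmetry and absence of atoms, the two tails share the complementary mass equally. -/
lemma real_Ici_gaussianReal {c : ℝ} (hc : 0 ≤ c) :
    (gaussianReal 0 1).real (Ici c) = (1 - (gaussianReal 0 1).real (Icc (-c) c)) / 2 := by
  have := nullSingletonClass_gaussianReal (μ := 0) (v := 1) one_ne_zero
  have hsymm : (gaussianReal 0 1).real (Iio (-c)) = (gaussianReal 0 1).real (Ici c) := by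
    have h1 : (gaussianReal 0 1).real (Ici c) = (gaussianReal 0 1).real (Iic (-c)) := by
      conv_lhs => rw [← neg_zero, ← gaussianReal_map_neg]
      rw [map_measureReal_apply measurable_neg measurableSet_Ici]
      simp
    rw [h1]
    exact measureReal_congr Iio_ae_eq_Iic
  have hcompl : (gaussianReal 0 1).real (Iio (-c) ∪ Ioi c) =
      1 - (gaussianReal 0 1).real (Icc (-c) c) := by
    rw [← probReal_compl_eq_one_sub measurableSet_Icc]
    congr 1
    ext x
    simp only [mem_union, mem_Iio, mem_Ioi, mem_compl_iff, mem_Icc, not_and_or, not_le]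
  rw [measureReal_union (by
    rw [Set.disjoint_left]; intro x hx hx'; simp only [mem_Iio, mem_Ioi] at hx hx'; linarith)
    measurableSet_Ioi, hsymm] at hcompl
  have h2 : (gaussianReal 0 1).real (Ioi c) = (gaussianReal 0 1).real (Ici c) :=
    measureReal_congr Ioi_ae_eq_Ici
  linarith

/-- The mass that the standard normal distribution gives to symmetric intervals takes all values
in `[0, 1)`. -/
lemma exists_real_Icc_gaussianReal_eq {v : ℝ} (h0 : 0 ≤ v) (h1 : v < 1) :
    ∃ c : ℝ, 0 ≤ c ∧ (gaussianReal 0 1).real (Icc (-c) c) = v := by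
  obtain ⟨b, hb, hvb⟩ := exists_lt_real_Icc (gaussianReal 0 1) h1
  have hi : ∀ a b : ℝ, IntervalIntegrable (gaussianPDFReal 0 1) volume a b :=
    fun a b => (integrable_gaussianPDFReal 0 1).intervalIntegrable
  have hcont : Continuous fun c : ℝ => ∫ x in -c..c, gaussianPDFReal 0 1 x := by
    have heq : (fun c : ℝ => ∫ x in -c..c, gaussianPDFReal 0 1 x) =
        fun c => (∫ x in 0..c, gaussianPDFReal 0 1 x) - ∫ x in 0..-c, gaussianPDFReal 0 1 x := by
      ext c
      rw [intervalIntegral.integral_interval_sub_left (hi _ _) (hi _ _)]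
    rw [heq]
    have hp := intervalIntegral.continuous_primitive hi 0
    exact hp.sub (hp.comp continuous_neg)
  rw [real_Icc_gaussianReal hb] at hvb
  obtain ⟨c, hc, hcv⟩ := intermediate_value_Icc hb hcont.continuousOn
    (show v ∈ Icc _ _ from ⟨by simpa using h0, hvb.le⟩)
  exact ⟨c, hc.1, (real_Icc_gaussianReal hc.1).trans hcv⟩

/-! ### Critical values of the t-distribution -/

lemma measurable_studentT_ratio (ν : ℕ) : Measurable fun z : Fin (ν + 1) → ℝ =>
    z 0 / √((∑ i : Fin ν, z i.succ ^ 2) / (ν : ℝ)) := by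
  fun_prop

instance isProbabilityMeasure_studentT (ν : ℕ) : IsProbabilityMeasure (studentT ν) :=
  Measure.isProbabilityMeasure_map (measurable_studentT_ratio ν).aemeasurable

lemma tCrit_nonneg (ν : ℕ) (α : ℝ) : 0 ≤ tCrit ν α :=
  Real.sInf_nonneg fun _ hc => hc.1

/-- The first `n` coordinates of an i.i.d. sequence follow the finite product measure. -/
lemma measurePreserving_infinitePi_fin (μ : Measure ℝ) [IsProbabilityMeasure μ] (n : ℕ) :
    MeasurePreserving (fun (ω : ℕ → ℝ) (i : Fin n) => ω i)
      (Measure.infinitePi fun _ : ℕ => μ) (Measure.pi fun _ : Fin n => μ) where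
  measurable := by fun_prop
  map_eq := by
    rw [← Measure.infinitePi_eq_pi]
    exact Measure.map_infinitePi_infinitePi_of_inj (P := fun _ : ℕ => μ) Fin.val_injective

section Coordinates

variable (μ : Measure ℝ) [IsProbabilityMeasure μ]

lemma iIndepFun_eval : iIndepFun (fun (i : ℕ) (ω : ℕ → ℝ) => ω i)
    (Measure.infinitePi fun _ : ℕ => μ) :=
  iIndepFun_infinitePi (X := fun _ x => x) (by fun_prop)

lemma hasLaw_eval (i : ℕ) : HasLaw (fun ω : ℕ → ℝ => ω i) μ
    (Measure.infinitePi fun _ : ℕ => μ) :=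
  ⟨(measurable_pi_apply i).aemeasurable, Measure.infinitePi_map_eval _ i⟩

/-- The strong law of large numbers for a function of the coordinates of an i.i.d. sequence. -/
lemma strong_law_eval {f : ℝ → ℝ} (hf : Measurable f) (hint : Integrable f μ) (k : ℕ) :
    ∀ᵐ ω ∂(Measure.infinitePi fun _ : ℕ => μ),
      Tendsto (fun n : ℕ => (∑ i : Fin n, f (ω (i + k))) / n) atTop (𝓝 (∫ x, f x ∂μ)) := by
  have hlaw := hasLaw_eval μ
  have key := strong_law_ae_real (μ := Measure.infinitePi fun _ : ℕ => μ)
    (fun i ω => f (ω (i + k)))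
    (((hlaw (0 + k)).map_eq.symm ▸ hint).comp_measurable (by fun_prop))
    (fun i j hij => ((iIndepFun_eval μ).indepFun (i := i + k) (j := j + k)
      (by simpa using hij)).comp hf hf)
    (fun i => IdentDistrib.comp ⟨(hlaw _).aemeasurable, (hlaw _).aemeasurable,
      (hlaw (i + k)).map_eq.trans (hlaw (0 + k)).map_eq.symm⟩ hf)
  filter_upwards [key] with ω hω
  have hE : ∫ ω : ℕ → ℝ, f (ω (0 + k)) ∂(Measure.infinitePi fun _ : ℕ => μ) = ∫ x, f x ∂μ :=
    (hlaw (0 + k)).integral_comp (f := f) hint.1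
  rw [hE] at hω
  simpa only [Fin.sum_univ_eq_sum_range (fun i => f (ω (i + k)))] using hω

end Coordinates

/-- The t-distributions converge to the standard normal distribution. -/
lemma eventually_studentT_real_Icc_lt {c b : ℝ} (hb : (gaussianReal 0 1).real (Icc (-c) c) < b) :
    ∀ᶠ ν in atTop, (studentT ν).real (Icc (-c) c) < b := by
  set P := Measure.infinitePi fun _ : ℕ => gaussianReal 0 1
  have hsq : Integrable (fun x : ℝ => x ^ 2) (gaussianReal 0 1) :=
    (memLp_id_gaussianReal 2).integrable_sq
  have hvar : ∫ x : ℝ, x ^ 2 ∂(gaussianReal 0 1) = 1 := by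
    have h := variance_id_gaussianReal (μ := 0) (v := 1)
    rw [variance_of_integral_eq_zero (by fun_prop) (by simp)] at h
    simpa using h
  -- The numerator is the same coordinate for every `ν` and the denominator tends to `1` by the
  -- strong law, so the ratios converge almost surely.
  have hdist : TendstoInDistribution
      (fun (ν : ℕ) (ω : ℕ → ℝ) => ω 0 / √((∑ i : Fin ν, ω (i + 1) ^ 2) / (ν : ℝ))) atTop
      (fun ω => ω 0) (fun _ => P) P := by
    refine tendstoInDistribution_of_ae_tendsto (fun ν => by fun_prop)
      (measurable_pi_apply 0).aemeasurable ?_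
    have hs := strong_law_eval (gaussianReal 0 1) (f := fun x => x ^ 2) (by fun_prop) hsq 1
    filter_upwards [hs] with ω hω
    rw [hvar] at hω
    have := (tendsto_const_nhds (x := ω 0)).div hω.sqrt (by simp)
    simpa [Pi.div_def] using this
  have hlim : P.real ((fun ω : ℕ → ℝ => ω 0) ⁻¹' Icc (-c) c) < b := by
    rwa [← map_measureReal_apply (by fun_prop) measurableSet_Icc,
      (hasLaw_eval (gaussianReal 0 1) 0).map_eq]
  filter_upwards [TendstoInDistribution.eventually_real_preimage_lt hdist isClosed_Icc hlim]
    with ν hν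
  rw [studentT, map_measureReal_apply (measurable_studentT_ratio ν) measurableSet_Icc,
    ← (measurePreserving_infinitePi_fin (gaussianReal 0 1) (ν + 1)).measureReal_preimage
      (measurable_studentT_ratio ν measurableSet_Icc).nullMeasurableSet]
  simpa [preimage, P] using hν

/-- A critical value below `c` would force the t-mass of `[-c, c]` up to `1 - α`, against its normal
limit. This one-sided bound replaces convergence of the critical values. -/
lemma eventually_le_tCrit {c α : ℝ} (hα : 0 < α)
    (hc : (gaussianReal 0 1).real (Icc (-c) c) < 1 - α) : ∀ᶠ ν in atTop, c ≤ tCrit ν α := by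
  filter_upwards [eventually_studentT_real_Icc_lt hc] with ν hν
  -- The set defining `tCrit` must be non-empty; otherwise its `sInf` would be the default `0`.
  obtain ⟨d, hd, hd'⟩ := exists_lt_real_Icc (studentT ν) (show 1 - α < 1 by linarith)
  refine le_csInf ⟨d, hd, hd'.le⟩ fun e he => ?_
  by_contra! hlt
  refine (he.2.trans_lt (lt_of_le_of_lt ?_ hν)).false
  exact measureReal_mono (Icc_subset_Icc (by linarith) hlt.le)

/-! ### One-sided coverage of the normal-theory interval -/

lemma measurable_sampleMean (N : ℕ) : Measurable (sampleMean (N := N)) := by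
  unfold sampleMean
  fun_prop

lemma measurable_sampleSD (N : ℕ) : Measurable (sampleSD (N := N)) := by
  have := measurable_sampleMean N
  unfold sampleSD
  fun_prop

lemma measurable_lowerBound (N : ℕ) (α : ℝ) : Measurable (lowerBound (N := N) α) := by
  have := measurable_sampleMean N
  have := measurable_sampleSD N
  unfold lowerBound
  fun_prop

/-- Reflection reduces the upper confidence bound to the lower one. -/
lemma upperBound_eq_neg_lowerBound_neg {N : ℕ} (α : ℝ) (y : Fin N → ℝ) :
    upperBound α y = -lowerBound α (fun i => -y i) := by
  have hm : sampleMean (fun i => -y i) = -sampleMean y := by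
    simp [sampleMean, Finset.sum_neg_distrib, neg_div]
  have hs : sampleSD (fun i => -y i) = sampleSD y := by
    unfold sampleSD
    rw [hm]
    congr 2
    exact Finset.sum_congr rfl fun i _ => by ring
  rw [upperBound, lowerBound, hm, hs]
  ring

lemma measurable_upperBound (N : ℕ) (α : ℝ) : Measurable (upperBound (N := N) α) := by
  have := measurable_lowerBound N α
  rw [show upperBound (N := N) α = _ from funext (upperBound_eq_neg_lowerBound_neg α)]
  fun_prop

/-- Expresses the deviation through the first two empirical moments, to which the strong law
applies. For `N = 1` both sides are `0` by the convention for division by zero. -/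
lemma sampleSD_eq {N : ℕ} (hN : 0 < N) (y : Fin N → ℝ) :
    sampleSD y =
      √(((∑ i, y i ^ 2) / N - ((∑ i, y i) / N) ^ 2) * ((N : ℝ) / ((N : ℝ) - 1))) := by
  have hN' : (N : ℝ) ≠ 0 := by positivity
  unfold sampleSD
  have h : ∑ i, (y i - sampleMean y) ^ 2 =
      ((∑ i, y i ^ 2) / N - ((∑ i, y i) / N) ^ 2) * N := by
    simp only [sub_sq, Finset.sum_add_distrib, Finset.sum_sub_distrib, ← Finset.mul_sum,
      ← Finset.sum_mul, Finset.sum_const, Finset.card_univ, Fintype.card_fin, nsmul_eq_mul,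
      sampleMean]
    field_simp
    ring
  rw [h, mul_div_assoc]

/-- The sample standard deviation is strongly consistent. -/
lemma ae_tendsto_sampleSD (μ : Measure ℝ) [IsProbabilityMeasure μ] (hμ : MemLp id 2 μ) :
    ∀ᵐ ω ∂(Measure.infinitePi fun _ : ℕ => μ),
      Tendsto (fun n : ℕ => sampleSD fun i : Fin n => ω i) atTop (𝓝 √Var[id; μ]) := by
  have hint : Integrable (fun x : ℝ => x) μ := hμ.integrable one_le_two
  filter_upwards [strong_law_eval μ measurable_id hint 0,
    strong_law_eval μ (f := fun x => x ^ 2) (by fun_prop) hμ.integrable_sq 0] with ω h1 h2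
  have h3 : Tendsto (fun n : ℕ => (n : ℝ) / ((n : ℝ) - 1)) atTop (𝓝 1) := by
    simpa [sub_eq_add_neg] using tendsto_natCast_div_add_atTop (𝕜 := ℝ) (-1)
  have h := ((h2.sub (h1.pow 2)).mul h3).sqrt
  have hv : (∫ x, x ^ 2 ∂μ - (∫ x, id x ∂μ) ^ 2) * 1 = Var[id; μ] := by
    rw [variance_eq_sub hμ]
    simp
  rw [hv] at h
  refine h.congr' ?_
  filter_upwards [eventually_gt_atTop 0] with n hn
  rw [sampleSD_eq hn]
  simp

/-- The failure probability of the lower confidence bound for the mean of a square-integrable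
distribution is asymptotically at most `α / 2`. -/
lemma eventually_real_lt_lowerBound (μ : Measure ℝ) [IsProbabilityMeasure μ] (hμ : MemLp id 2 μ)
    {α : ℝ} (hα0 : 0 < α) (hα1 : α < 1) {ε : ℝ} (hε : 0 < ε) :
    ∀ᶠ N in atTop, (Measure.pi fun _ : Fin N => μ).real
      {y | ∫ x, x ∂μ < lowerBound α y} < α / 2 + ε := by
  set P := Measure.infinitePi fun _ : ℕ => μ
  set m := ∫ x, x ∂μ
  set v := Var[id; μ]
  have hlaw := hasLaw_eval μ
  have hid (i : ℕ) : IdentDistrib (fun ω : ℕ → ℝ => ω i) id P μ :=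
    ⟨(hlaw i).aemeasurable, aemeasurable_id, by rw [(hlaw i).map_eq, Measure.map_id]⟩
  suffices h : ∀ᶠ N in atTop, P.real {ω | m < lowerBound α fun i : Fin N => ω i} < α / 2 + ε by
    filter_upwards [h] with N hN
    have hs : MeasurableSet {y : Fin N → ℝ | m < lowerBound α y} :=
      measurableSet_lt measurable_const (measurable_lowerBound N α)
    rw [← (measurePreserving_infinitePi_fin μ N).measureReal_preimage hs.nullMeasurableSet]
    exact hN
  rcases (variance_nonneg id μ).eq_or_lt with hv | hv
  -- Degenerate case: the sample is almost surely constant, so the lower bound cannot exceed `m`.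
  · have hconst : ∀ᵐ ω ∂P, ∀ i : ℕ, ω i = m := by
      refine ae_all_iff.2 fun i => ?_
      have h0 : ∀ᵐ x ∂μ, x = m := by
        filter_upwards [ae_eq_integral_of_variance_eq_zero hμ hv.symm] with x hx
        simpa using hx
      exact (measurePreserving_eval_infinitePi (fun _ : ℕ => μ) i).quasiMeasurePreserving.ae h0
    filter_upwards [eventually_gt_atTop 0] with N hN
    have hz : P.real {ω | m < lowerBound α fun i : Fin N => ω i} = 0 := by
      rw [measureReal_eq_zero_iff]
      refine measure_mono_null (t := {ω | ¬ ∀ i : ℕ, ω i = m}) (fun ω hω hc => ?_) hconst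
      have hm : sampleMean (fun i : Fin N => ω i) = m := by
        have : (N : ℝ) ≠ 0 := by positivity
        simp only [sampleMean, hc, Finset.sum_const, Finset.card_univ, Fintype.card_fin,
          nsmul_eq_mul]
        field_simp
      have hnn : 0 ≤ tCrit (N - 1) α * (sampleSD (fun i : Fin N => ω i) / √(N : ℝ)) :=
        mul_nonneg (tCrit_nonneg _ _) (div_nonneg (Real.sqrt_nonneg _) (Real.sqrt_nonneg _))
      simp only [mem_ofPred_eq, lowerBound, hm] at hω
      linarith
    rw [hz]
    positivity
  -- The central mass is strictly below `1 - α`, so `c` is eventually at most the critical value,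
  -- while the upper tail is at most `(α + ε) / 2`. The `max` covers `1 - α - ε < 0`.
  · obtain ⟨c, hc0, hc⟩ := exists_real_Icc_gaussianReal_eq
      (v := max 0 (1 - α - ε)) (le_max_left _ _) (max_lt one_pos (by linarith))
    have hc1 : (gaussianReal 0 1).real (Icc (-c) c) < 1 - α := by
      rw [hc]
      exact max_lt (by linarith) (by linarith)
    have hc2 : (gaussianReal 0 1).real (Ici c) < α / 2 + ε := by
      rw [real_Ici_gaussianReal hc0, hc]
      have := le_max_right 0 (1 - α - ε)
      linarith
    have hvar : Var[fun ω : ℕ → ℝ => ω 0; P] = v := (hid 0).variance_eq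
    have hY : HasLaw (fun x => √v * x) (gaussianReal 0 Var[fun ω : ℕ → ℝ => ω 0; P].toNNReal)
        (gaussianReal 0 1) := by
      have h : HasLaw (fun x => √v * x) _ (gaussianReal 0 1) :=
        gaussianReal_const_mul (HasLaw.id (μ := gaussianReal 0 1)) √v
      convert h using 1
      rw [hvar]
      congr 1
      · simp
      · ext
        have hv' : 0 ≤ v := hv.le
        simp [Real.sq_sqrt hv', hv']
    have hclt := tendstoInDistribution_inv_sqrt_mul_sum_sub (P := P)
      (X := fun (i : ℕ) (ω : ℕ → ℝ) => ω i) hY ((hid 0).memLp_iff.2 hμ) (iIndepFun_eval μ)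
      (fun i => (hid i).trans (hid 0).symm)
    have hmeas : ∀ n : ℕ, Measurable fun ω : ℕ → ℝ => sampleSD fun i : Fin n => ω i :=
      fun n => (measurable_sampleSD n).comp (by fun_prop)
    have hSD : TendstoInMeasure P (fun (n : ℕ) (ω : ℕ → ℝ) => sampleSD fun i : Fin n => ω i)
        atTop (fun _ => √v) :=
      tendstoInMeasure_of_tendsto_ae (fun n => (hmeas n).aestronglyMeasurable)
        (ae_tendsto_sampleSD μ hμ)
    -- Slutsky in the form `√N (mean - m) - c * SD`, which avoids dividing by a possibly zero
    -- deviation.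
    have hdist := hclt.continuous_comp_prodMk_of_tendstoInMeasure_const
      (g := fun p : ℝ × ℝ => p.1 - c * p.2) (by fun_prop) hSD fun n => (hmeas n).aemeasurable
    have hlim : (gaussianReal 0 1).real ((fun x => √v * x - c * √v) ⁻¹' Ici 0) < α / 2 + ε := by
      convert hc2 using 2
      ext x
      have : 0 < √v := Real.sqrt_pos.2 hv
      rw [mem_preimage, mem_Ici, mem_Ici, sub_nonneg, mul_comm c, mul_le_mul_iff_right₀ this]
    have hmean : ∫ ω : ℕ → ℝ, ω 0 ∂P = m := (hid 0).integral_eq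
    have htc := (tendsto_sub_atTop_nat 1).eventually (eventually_le_tCrit hα0 hc1)
    filter_upwards [TendstoInDistribution.eventually_real_preimage_lt hdist isClosed_Ici hlim,
      htc, eventually_gt_atTop 0] with N hN ht hpos
    -- Failure gives `√N (mean - m) ≥ tCrit * SD ≥ c * SD`, which is a closed event.
    refine lt_of_le_of_lt (measureReal_mono fun ω hω => ?_) hN
    have hN0 : (0 : ℝ) < N := by exact_mod_cast hpos
    have hsq : 0 < √(N : ℝ) := Real.sqrt_pos.2 hN0
    have hsd : 0 ≤ sampleSD fun i : Fin N => ω i := Real.sqrt_nonneg _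
    simp only [mem_ofPred_eq, lowerBound, sampleMean,
      Fin.sum_univ_eq_sum_range (fun i => ω i)] at hω
    simp only [mem_preimage, mem_Ici, hmean]
    have e1 : (√(N : ℝ))⁻¹ * (∑ k ∈ Finset.range N, ω k - N * m) =
        √(N : ℝ) * ((∑ k ∈ Finset.range N, ω k) / N - m) := by
      have h2 : √(N : ℝ) * √(N : ℝ) = N := Real.mul_self_sqrt hN0.le
      field_simp
      rw [sq, h2]
    have e2 : tCrit (N - 1) α * (sampleSD fun i : Fin N => ω i) ≤
        √(N : ℝ) * ((∑ k ∈ Finset.range N, ω k) / N - m) := by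
      have h3 : tCrit (N - 1) α * ((sampleSD fun i : Fin N => ω i) / √(N : ℝ)) ≤
          (∑ k ∈ Finset.range N, ω k) / N - m := by linarith
      calc _ = √(N : ℝ) * (tCrit (N - 1) α * ((sampleSD fun i : Fin N => ω i) / √(N : ℝ))) := by
            field_simp
        _ ≤ _ := mul_le_mul_of_nonneg_left h3 hsq.le
    have e3 := mul_le_mul_of_nonneg_right ht hsd
    rw [e1]
    linarith

/-- The failure probability of the upper confidence bound for the mean of a square-integrable
distribution is asymptotically at most `α / 2`. -/
lemma eventually_real_upperBound_lt (μ : Measure ℝ) [IsProbabilityMeasure μ] (hμ : MemLp id 2 μ)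
    {α : ℝ} (hα0 : 0 < α) (hα1 : α < 1) {ε : ℝ} (hε : 0 < ε) :
    ∀ᶠ N in atTop, (Measure.pi fun _ : Fin N => μ).real
      {y | upperBound α y < ∫ x, x ∂μ} < α / 2 + ε := by
  have hneg : AEMeasurable (fun x : ℝ => -x) μ := by fun_prop
  have : IsProbabilityMeasure (μ.map fun x => -x) := Measure.isProbabilityMeasure_map hneg
  have hμ' : MemLp id 2 (μ.map fun x => -x) :=
    (memLp_map_measure_iff (by fun_prop) hneg).2 hμ.neg
  filter_upwards [eventually_real_lt_lowerBound _ hμ' hα0 hα1 hε] with N hN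
  have hs : MeasurableSet {y : Fin N → ℝ | ∫ x, x ∂(μ.map fun x => -x) < lowerBound α y} :=
    measurableSet_lt measurable_const (measurable_lowerBound N α)
  rw [← Measure.pi_map_pi fun _ => hneg, map_measureReal_apply (by fun_prop) hs,
    integral_map hneg (by fun_prop), integral_neg] at hN
  convert hN using 2
  ext y
  simp only [mem_ofPred_eq, mem_preimage, upperBound_eq_neg_lowerBound_neg]
  exact neg_lt

/-! ### Laws of the observations -/

section Observations

variable {Ω 𝒳 : Type*} {mΩ : MeasurableSpace Ω} {m𝒳 : MeasurableSpace 𝒳} {P : Measure Ω}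
  {N : ℕ} {χ χ' : Fin N → Ω → 𝒳} {ρ : Measure 𝒳}

/-- A function of i.i.d. observations has an i.i.d. law. -/
lemma map_comp_eq_pi (hind : iIndepFun χ P) (hχ : ∀ i, HasLaw (χ i) ρ P) {f : 𝒳 → ℝ}
    (hf : Measurable f) :
    P.map (fun ω i => f (χ i ω)) = Measure.pi fun _ : Fin N => ρ.map f := by
  have h := iIndepFun.map_fun_eq_pi_map (fun i => hf.comp_aemeasurable (hχ i).aemeasurable)
    (hind.comp (fun _ => f) fun _ => hf)
  refine h.trans ?_
  congr 1
  ext1 i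
  rw [← AEMeasurable.map_map_of_aemeasurable hf.aemeasurable (hχ i).aemeasurable, (hχ i).map_eq]

/-- A function of pairs of independent i.i.d. observations has an i.i.d. law. -/
lemma map_comp_prod_eq_pi [IsProbabilityMeasure ρ] (hind : iIndepFun (Sum.elim χ χ') P) (hχ : ∀ i, HasLaw (χ i) ρ P)
    (hχ' : ∀ i, HasLaw (χ' i) ρ P) {f : 𝒳 × 𝒳 → ℝ} (hf : Measurable f) :
    P.map (fun ω i => f (χ i ω, χ' i ω)) =
      Measure.pi fun _ : Fin N => (ρ.prod ρ).map f := by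
  have hlaw : ∀ s, HasLaw (Sum.elim χ χ' s) ρ P := by
    rintro (i | i)
    exacts [hχ i, hχ' i]
  have hae : AEMeasurable (fun ω s => Sum.elim χ χ' s ω) P :=
    aemeasurable_pi_lambda _ fun s => (hlaw s).aemeasurable
  have h1 : P.map (fun ω s => Sum.elim χ χ' s ω) = Measure.pi fun _ : Fin N ⊕ Fin N => ρ := by
    rw [iIndepFun.map_fun_eq_pi_map (fun s => (hlaw s).aemeasurable) hind]
    congr 1
    ext1 s
    exact (hlaw s).map_eq
  -- Two measure-preserving rearrangements turn the family indexed by `Fin N ⊕ Fin N` into `N`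
  -- i.i.d. pairs.
  have h2 := (measurePreserving_sumPiEquivProdPi fun _ : Fin N ⊕ Fin N => ρ).map_eq
  have h3 := (measurePreserving_arrowProdEquivProdArrow 𝒳 𝒳 (Fin N)
    (fun _ => ρ) (fun _ => ρ)).symm.map_eq
  have hF : Measurable fun (p : Fin N → 𝒳 × 𝒳) i => f (p i) := by fun_prop
  rw [← Measure.pi_map_pi fun _ => hf.aemeasurable, ← h3, ← h2, ← h1,
    AEMeasurable.map_map_of_aemeasurable (by fun_prop) hae,
    AEMeasurable.map_map_of_aemeasurable (by fun_prop)
      ((MeasurableEquiv.measurable _).comp_aemeasurable hae),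
    AEMeasurable.map_map_of_aemeasurable hF.aemeasurable
      ((MeasurableEquiv.measurable _).comp_aemeasurable
        ((MeasurableEquiv.measurable _).comp_aemeasurable hae))]
  rfl

end Observations

/-! ### The estimators -/

section Estimators

variable {𝒳 T : Type*} {m𝒳 : MeasurableSpace 𝒳} {θhat : 𝒳 → T → ℝ} {τ : 𝒳 → T}

/-- The infimum is attained at `τ x`; as the diagonal of the upper estimator, the lower one inherits
its measurability. -/
lemma lowerEst_eq (hτmin : ∀ x t, θhat x (τ x) ≤ θhat x t) (x : 𝒳) :
    lowerEst θhat x = upperEst θhat τ x x := by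
  have : Nonempty T := ⟨τ x⟩
  exact (ciInf_le ⟨_, Set.forall_mem_range.2 (hτmin x)⟩ (τ x)).antisymm (le_ciInf (hτmin x))

/-- A Carathéodory function is jointly measurable and can be composed with `(τ x', x)`. -/
lemma measurable_upperEst [TopologicalSpace T] [TopologicalSpace.MetrizableSpace T]
    [SecondCountableTopology T] [MeasurableSpace T] [BorelSpace T]
    (hmeas : ∀ t, Measurable fun x => θhat x t) (hcont : ∀ x, Continuous (θhat x))
    (hτ : Measurable τ) : Measurable fun p : 𝒳 × 𝒳 => upperEst θhat τ p.1 p.2 :=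
  (measurable_uncurry_of_continuous_of_measurable (u := fun t x => θhat x t) hcont hmeas).comp
    ((hτ.comp measurable_snd).prodMk measurable_fst)

variable {ρ : Measure 𝒳} [IsProbabilityMeasure ρ] {θ : T → ℝ} {θstar β : ℝ}

/-- The lower estimator underestimates the minimum up to the bias bound. -/
lemma integral_lowerEst_le
    (hmeas₁ : Measurable fun x => upperEst θhat τ x x) (hmeas : ∀ t, Measurable fun x => θhat x t)
    {M : ℝ} (hM : ∀ x t, |θhat x t| ≤ M) (hτmin : ∀ x t, θhat x (τ x) ≤ θhat x t)
    (hθ : IsLeast (Set.range θ) θstar) (hβ : ∀ t, |(∫ x, θhat x t ∂ρ) - θ t| ≤ β) :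
    ∫ x, upperEst θhat τ x x ∂ρ ≤ θstar + β := by
  obtain ⟨⟨t, ht⟩, -⟩ := hθ
  have h : ∫ x, upperEst θhat τ x x ∂ρ ≤ ∫ x, θhat x t ∂ρ :=
    integral_mono (Integrable.of_bound hmeas₁.aestronglyMeasurable M (ae_of_all _ fun x => hM x _))
      (Integrable.of_bound (hmeas t).aestronglyMeasurable M (ae_of_all _ fun x => hM x t))
      fun x => hτmin x t
  have := (abs_le.1 (hβ t)).2
  linarith

/-- The upper estimator overestimates the minimum up to the bias bound. -/
lemma le_integral_upperEst
    (hmeas₂ : Measurable fun p : 𝒳 × 𝒳 => upperEst θhat τ p.1 p.2)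
    {M : ℝ} (hM : ∀ x t, |θhat x t| ≤ M)
    (hθ : IsLeast (Set.range θ) θstar) (hβ : ∀ t, |(∫ x, θhat x t ∂ρ) - θ t| ≤ β) :
    θstar - β ≤ ∫ p, upperEst θhat τ p.1 p.2 ∂(ρ.prod ρ) := by
  have hint : Integrable (fun p : 𝒳 × 𝒳 => upperEst θhat τ p.1 p.2) (ρ.prod ρ) :=
    Integrable.of_bound hmeas₂.aestronglyMeasurable M (ae_of_all _ fun p => hM _ _)
  -- With `x'` as the outer variable, the inner integral is the expectation at the fixed parameter
  -- `τ x'`, where the bias bound applies.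
  rw [integral_prod_symm _ hint]
  calc θstar - β = ∫ _, (θstar - β) ∂ρ := by simp
    _ ≤ _ := integral_mono (integrable_const _) hint.integral_prod_right fun x' => by
      have h1 := (abs_le.1 (hβ (τ x'))).1
      have h2 := hθ.2 ⟨τ x', rfl⟩
      change θstar - β ≤ ∫ x, θhat x (τ x') ∂ρ
      linarith

end Estimators

lemma memLp_id_map_of_bound {𝒴 : Type*} {m𝒴 : MeasurableSpace 𝒴} {ρ : Measure 𝒴}
    [IsFiniteMeasure ρ] {f : 𝒴 → ℝ} (hf : Measurable f) {M : ℝ} (hM : ∀ y, |f y| ≤ M) :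
    MemLp id 2 (ρ.map f) :=
  (memLp_map_measure_iff (by fun_prop) hf.aemeasurable).2
    (MemLp.of_bound hf.aestronglyMeasurable M (ae_of_all _ hM))

end ImpreciseEstimation

/-! ### Union bound over the two failure events -/

theorem mainTheorem10
    {𝒳 : Type*} [MeasurableSpace 𝒳]
    -- the random variable `X`
    {Ω₀ : Type*} [MeasurableSpace Ω₀] (P₀ : Measure Ω₀) [IsProbabilityMeasure P₀]
    (X : Ω₀ → 𝒳) (hX : AEMeasurable X P₀)
    -- the compact parameter set and the uniformly bounded family of estimators
    {k : ℕ} (T : Set (EuclideanSpace ℝ (Fin k))) (hT : IsCompact T)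
    (θhat : 𝒳 → T → ℝ)
    (hmeas : ∀ t, Measurable fun x => θhat x t)
    (hcont : ∀ x, Continuous (θhat x))
    (hbdd : ∃ M : ℝ, ∀ x t, |θhat x t| ≤ M)
    -- the measurable choice of a minimiser
    (τ : 𝒳 → T) (hτ : Measurable τ) (hτmin : ∀ x t, θhat x (τ x) ≤ θhat x t)
    -- the estimated function, its minimum, and the uniform bound on the bias
    (θ : T → ℝ) (θstar : ℝ) (hθ : IsLeast (Set.range θ) θstar)
    (β : ℝ) (hβ : ∀ t, |(∫ ω, θhat (X ω) t ∂P₀) - θ t| ≤ β)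
    (α : ℝ) (hα0 : 0 < α) (hα1 : α < 1) :
    ∀ ε : ℝ, 0 < ε → ∃ N₀ : ℕ, ∀ N : ℕ, N₀ ≤ N →
      ∀ (Ω : Type*) [MeasurableSpace Ω] (P : Measure Ω) [IsProbabilityMeasure P]
        (χ χ' : Fin N → Ω → 𝒳),
        iIndepFun (Sum.elim χ χ') P →
        (∀ i, IdentDistrib (χ i) X P P₀) →
        (∀ i, IdentDistrib (χ' i) X P P₀) →
        1 - α - ε ≤ P.real {ω |
          ImpreciseEstimation.lowerBound α
              (fun i => ImpreciseEstimation.lowerEst θhat (χ i ω)) - β ≤ θstar ∧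
          θstar ≤ ImpreciseEstimation.upperBound α
              (fun i => ImpreciseEstimation.upperEst θhat τ (χ i ω) (χ' i ω)) + β} := by
  intro ε hε
  obtain ⟨M, hM⟩ := hbdd
  have hρ : IsProbabilityMeasure (P₀.map X) := Measure.isProbabilityMeasure_map hX
  set ρ := P₀.map X
  have hβ' : ∀ t, |(∫ x, θhat x t ∂ρ) - θ t| ≤ β := fun t => by
    rw [integral_map hX (hmeas t).aestronglyMeasurable]
    exact hβ t
  have hm₂ := ImpreciseEstimation.measurable_upperEst hmeas hcont hτ
  have hm₁ : Measurable fun x => ImpreciseEstimation.upperEst θhat τ x x :=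
    hm₂.comp (measurable_id.prodMk measurable_id)
  set f₁ := fun x => ImpreciseEstimation.upperEst θhat τ x x
  set f₂ := fun p : 𝒳 × 𝒳 => ImpreciseEstimation.upperEst θhat τ p.1 p.2
  have hp₁ : IsProbabilityMeasure (ρ.map f₁) := Measure.isProbabilityMeasure_map hm₁.aemeasurable
  have hp₂ : IsProbabilityMeasure ((ρ.prod ρ).map f₂) :=
    Measure.isProbabilityMeasure_map hm₂.aemeasurable
  have hμ₁ : ∫ y, y ∂(ρ.map f₁) ≤ θstar + β := by
    rw [integral_map hm₁.aemeasurable (by fun_prop)]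
    exact ImpreciseEstimation.integral_lowerEst_le hm₁ hmeas hM hτmin hθ hβ'
  have hμ₂ : θstar - β ≤ ∫ y, y ∂((ρ.prod ρ).map f₂) := by
    rw [integral_map hm₂.aemeasurable (by fun_prop)]
    exact ImpreciseEstimation.le_integral_upperEst hm₂ hM hθ hβ'
  -- Each side may fail with probability `α / 2 + ε / 2`. Only the laws of the estimators enter, so
  -- `N₀` is fixed before `Ω`.
  have hev := (ImpreciseEstimation.eventually_real_lt_lowerBound (ρ.map f₁)
      (ImpreciseEstimation.memLp_id_map_of_bound hm₁ fun x => hM x _) hα0 hα1 (half_pos hε)).and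
    (ImpreciseEstimation.eventually_real_upperBound_lt ((ρ.prod ρ).map f₂)
      (ImpreciseEstimation.memLp_id_map_of_bound hm₂ fun p => hM p.1 _) hα0 hα1 (half_pos hε))
  obtain ⟨N₀, hN₀⟩ := Filter.eventually_atTop.1 hev
  refine ⟨N₀, fun N hN Ω _ P _ χ χ' hind hχ hχ' => ?_⟩
  obtain ⟨h₁, h₂⟩ := hN₀ N hN
  have hlaw : ∀ i, HasLaw (χ i) ρ P := fun i => ⟨(hχ i).aemeasurable_fst, (hχ i).map_eq⟩
  have hlaw' : ∀ i, HasLaw (χ' i) ρ P := fun i => ⟨(hχ' i).aemeasurable_fst, (hχ' i).map_eq⟩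
  have hl₁ := ImpreciseEstimation.map_comp_eq_pi (χ := χ)
    (hind.precomp (g := Sum.inl) Sum.inl_injective) hlaw hm₁
  have hl₂ := ImpreciseEstimation.map_comp_prod_eq_pi hind hlaw hlaw' hm₂
  have ha₁ : AEMeasurable (fun ω i => f₁ (χ i ω)) P :=
    aemeasurable_pi_lambda _ fun i => hm₁.comp_aemeasurable (hlaw i).aemeasurable
  have ha₂ : AEMeasurable (fun ω i => f₂ (χ i ω, χ' i ω)) P := aemeasurable_pi_lambda _ fun i =>
    hm₂.comp_aemeasurable ((hlaw i).aemeasurable.prodMk (hlaw' i).aemeasurable)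
  rw [← hl₁, map_measureReal_apply_of_aemeasurable ha₁ (measurableSet_lt measurable_const
    (ImpreciseEstimation.measurable_lowerBound N α))] at h₁
  rw [← hl₂, map_measureReal_apply_of_aemeasurable ha₂ (measurableSet_lt
    (ImpreciseEstimation.measurable_upperBound N α) measurable_const)] at h₂
  simp_rw [ImpreciseEstimation.lowerEst_eq hτmin]
  set A := {ω | ImpreciseEstimation.lowerBound α (fun i => f₁ (χ i ω)) - β ≤ θstar ∧
    θstar ≤ ImpreciseEstimation.upperBound α (fun i => f₂ (χ i ω, χ' i ω)) + β}
  change 1 - α - ε ≤ P.real A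
  set B₁ : Set Ω := (fun ω i => f₁ (χ i ω)) ⁻¹' _
  set B₂ : Set Ω := (fun ω i => f₂ (χ i ω, χ' i ω)) ⁻¹' _
  -- Covering the whole space and using subadditivity avoids proving `A` measurable.
  have hcover : Set.univ ⊆ A ∪ (B₁ ∪ B₂) := fun ω _ => by
    by_cases hω : ω ∈ A
    · exact Or.inl hω
    · right
      rcases not_and_or.1 hω with h | h
      · exact Or.inl (show ω ∈ B₁ from hμ₁.trans_lt (by linarith [not_le.1 h]))
      · exact Or.inr (show ω ∈ B₂ from lt_of_lt_of_le (by linarith [not_le.1 h]) hμ₂)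
  have htot := (measureReal_mono (μ := P) hcover).trans
    ((measureReal_union_le _ _).trans (add_le_add_right (measureReal_union_le _ _) _))
  rw [probReal_univ] at htot
  linarith
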